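/- Let $\sigma>0$, $\sigma_0>0$, $\mu\in\mathbb{R}$, and let $X$ be a real random variable with normal distribution $\mathcal N(\mu,\sigma_0^2)$. For $f\in L^2(\mathbb{R},\mathbb{C})$ let $\hat f$ denote the unitary Fourier transform, the $L^2$-extension of $\hat f(t)=\frac1{\sqrt{2\pi}}\int_{\mathbb{R}} f(x)e^{-itx}\,dx$. Let $\mathcal H_G$ be the reproducing kernel Hilbert space of real-valued functions of the Gaussian kernel $k_G(x,y)=\frac{1}{\sqrt{2\pi}\,\sigma}\exp\left(-\frac{(x-y)^2}{2\sigma^2}\right)$ on $\mathbb{R}$, that is, the real Hilbert space $$\mathcal H_G=\left\{f\in L^2(\mathbb{R},\mathbb{R}) : \int_{\mathbb{R}}|\hat f(t)|^2\exp\left(\tfrac{\sigma^2}{2}t^2\right)dt<\infty\right\},\qquad \langle f,g\rangle_{\mathcal H_G}=\int_{\mathbb{R}}\hat f(t)\,\overline{\hat g(t)}\,\exp\left(\tfrac{\sigma^2}{2}t^2\right)dt .$$ Let $C_{XX}:\mathcal H_G\to\mathcal H_G$ be the covariance operator of $X$, i.e. the bounded linear operator determined by $\langle C_{XX}f,g\rangle_{\mathcal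 H_G}=E[f(X)g(X)]$ for all $f,g\in\mathcal H_G$. Then for every $a\in\mathbb{R}$ the function $k_a(x)=\exp\left(-\frac{(x-a)^2}{2\sigma^2}\right)$ satisfies $k_a\in\mathcal H_G\setminus\mathrm{Ran}(C_{XX})$. In particular, $C_{XX}$ is not surjective. -/

import Mathlib

open MeasureTheory ProbabilityTheory FourierTransform

noncomputable section

namespace KernelBayes

/-- A real `L²` function regarded as a complex one. -/
def complexify (f : Lp ℝ 2 (volume : Measure ℝ)) : Lp ℂ 2 (volume : Measure ℝ) :=
  Complex.ofRealCLM.compLp f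

/-- The unitary Fourier transform on `L²(ℝ, ℂ)` in the angular frequency normalisation, i.e. the
`L²` extension of `f ↦ (t ↦ (2π)^(-1/2) ∫ f(x) exp(-itx) dx)`. Mathlib's `𝓕` is the `L²` extension
of `f ↦ (ξ ↦ ∫ f(x) exp(-2πixξ) dx)`, hence the rescaling. -/
def fourierL2 (f : Lp ℂ 2 (volume : Measure ℝ)) (t : ℝ) : ℂ :=
  ((√(2 * Real.pi))⁻¹ : ℝ) * (𝓕 f : Lp ℂ 2 (volume : Measure ℝ)) (t / (2 * Real.pi))

theorem two_pi_pos : (0 : ℝ) < 2 * Real.pi := by positivity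

theorem quasi_dilate :
    Measure.QuasiMeasurePreserving (fun t : ℝ => t / (2 * Real.pi)) volume volume := by
  have h := Measure.quasiMeasurePreserving_smul (volume : Measure ℝ)
    (r := (2 * Real.pi)⁻¹) (inv_ne_zero two_pi_pos.ne')
  simpa only [smul_eq_mul, div_eq_mul_inv, mul_comm] using h

theorem fourierL2_sq_integrable (f : Lp ℂ 2 (volume : Measure ℝ)) :
    Integrable (fun t => ‖fourierL2 f t‖ ^ 2) := by
  have h1 : Integrable (fun t : ℝ => ‖(𝓕 f : Lp ℂ 2 (volume : Measure ℝ)) t‖ ^ 2) :=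
    (memLp_two_iff_integrable_sq_norm (Lp.aestronglyMeasurable _)).1 (Lp.memLp _)
  have h2 := (h1.comp_div two_pi_pos.ne').const_mul (((√(2 * Real.pi))⁻¹) ^ 2)
  refine h2.congr (Filter.Eventually.of_forall fun t => ?_)
  simp only [fourierL2, norm_mul, mul_pow, Complex.norm_real, Real.norm_eq_abs, sq_abs]

theorem fourierL2_aesm (f : Lp ℂ 2 (volume : Measure ℝ)) :
    AEStronglyMeasurable (fourierL2 f) volume :=
  ((Lp.aestronglyMeasurable (𝓕 f : Lp ℂ 2 (volume : Measure ℝ))).comp_quasiMeasurePreserving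
    quasi_dilate).const_mul _

theorem fourierL2_memLp (f : Lp ℂ 2 (volume : Measure ℝ)) : MemLp (fourierL2 f) 2 volume :=
  (memLp_two_iff_integrable_sq_norm (fourierL2_aesm f)).2 (fourierL2_sq_integrable f)

theorem fourierL2_add (f g : Lp ℂ 2 (volume : Measure ℝ)) :
    fourierL2 (f + g) =ᵐ[volume] fun t => fourierL2 f t + fourierL2 g t := by
  have h : (𝓕 (f + g) : Lp ℂ 2 (volume : Measure ℝ)) = 𝓕 f + 𝓕 g :=
    (Lp.fourierTransformₗᵢ ℝ ℂ).map_add f g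
  have h2 := quasi_dilate.ae
    (Lp.coeFn_add (𝓕 f : Lp ℂ 2 (volume : Measure ℝ)) (𝓕 g : Lp ℂ 2 (volume : Measure ℝ)))
  filter_upwards [h2] with t ht
  simp only [fourierL2, h, ht, Pi.add_apply, mul_add]

theorem fourierL2_smul (c : ℂ) (f : Lp ℂ 2 (volume : Measure ℝ)) :
    fourierL2 (c • f) =ᵐ[volume] fun t => c * fourierL2 f t := by
  have h : (𝓕 (c • f) : Lp ℂ 2 (volume : Measure ℝ)) = c • 𝓕 f :=
    (Lp.fourierTransformₗᵢ ℝ ℂ).map_smul c f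
  have h2 := quasi_dilate.ae
    (Lp.coeFn_smul c (𝓕 f : Lp ℂ 2 (volume : Measure ℝ)))
  filter_upwards [h2] with t ht
  simp only [fourierL2, h, ht, Pi.smul_apply, smul_eq_mul]
  ring

theorem norm_sq_eq_integral (f : Lp ℂ 2 (volume : Measure ℝ)) :
    ‖f‖ ^ 2 = ∫ t, ‖f t‖ ^ 2 := by
  rw [← inner_self_eq_norm_sq (𝕜 := ℂ) f, L2.inner_def, ← integral_re (L2.integrable_inner f f)]
  simp only [inner_self_eq_norm_sq]

theorem fourierL2_integral (f : Lp ℂ 2 (volume : Measure ℝ)) :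
    ∫ t, ‖fourierL2 f t‖ ^ 2 = ‖f‖ ^ 2 := by
  have e : ∀ t, ‖fourierL2 f t‖ ^ 2 = (2 * Real.pi)⁻¹ *
      (fun s => ‖(𝓕 f : Lp ℂ 2 (volume : Measure ℝ)) s‖ ^ 2) (t / (2 * Real.pi)) := by
    intro t
    simp only [fourierL2, norm_mul, mul_pow, Complex.norm_real, Real.norm_eq_abs, sq_abs, inv_pow,
      Real.sq_sqrt two_pi_pos.le]
  simp_rw [e]
  rw [integral_const_mul,
    Measure.integral_comp_div (fun s => ‖(𝓕 f : Lp ℂ 2 (volume : Measure ℝ)) s‖ ^ 2), abs_of_pos two_pi_pos, smul_eq_mul,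
    ← mul_assoc, inv_mul_cancel₀ two_pi_pos.ne', one_mul, ← norm_sq_eq_integral, Lp.norm_fourier_eq]

theorem complexify_add (f g : Lp ℝ 2 (volume : Measure ℝ)) :
    complexify (f + g) = complexify f + complexify g :=
  (Complex.ofRealCLM.compLpL 2 volume).map_add f g

theorem complexify_smul (c : ℝ) (f : Lp ℝ 2 (volume : Measure ℝ)) :
    complexify (c • f) = (c : ℂ) • complexify f :=
  (Complex.ofRealCLM.compLpL 2 volume).map_smul c f

theorem norm_complexify (f : Lp ℝ 2 (volume : Measure ℝ)) : ‖complexify f‖ = ‖f‖ := by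
  rw [Lp.norm_def, Lp.norm_def]
  congr 1
  apply eLpNorm_congr_norm_ae
  filter_upwards [Complex.ofRealCLM.coeFn_compLp f] with t ht
  simp [complexify, ht]

/-- `f̂` for a real-valued `f ∈ L²(ℝ)`. -/
def fourierReal (f : Lp ℝ 2 (volume : Measure ℝ)) : ℝ → ℂ := fourierL2 (complexify f)

theorem fourierReal_add (f g : Lp ℝ 2 (volume : Measure ℝ)) :
    fourierReal (f + g) =ᵐ[volume] fun t => fourierReal f t + fourierReal g t := by
  unfold fourierReal
  rw [complexify_add]
  exact fourierL2_add _ _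

theorem fourierReal_smul (c : ℝ) (f : Lp ℝ 2 (volume : Measure ℝ)) :
    fourierReal (c • f) =ᵐ[volume] fun t => (c : ℂ) * fourierReal f t := by
  unfold fourierReal
  rw [complexify_smul]
  exact fourierL2_smul _ _

/-- The unitary Fourier transform as an isometry from real to complex `L²`. -/
def fourierIsometry : Lp ℝ 2 (volume : Measure ℝ) →ₗᵢ[ℝ] Lp ℂ 2 (volume : Measure ℝ) where
  toFun f := (fourierL2_memLp (complexify f)).toLp _
  map_add' f g := by
    rw [← MemLp.toLp_add]
    exact MemLp.toLp_congr _ _ (fourierReal_add f g)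
  map_smul' c f := by
    rw [RingHom.id_apply, ← MemLp.toLp_const_smul]
    refine MemLp.toLp_congr _ _ ((fourierReal_smul c f).trans ?_)
    exact Filter.Eventually.of_forall fun t => by simp [fourierReal]
  norm_map' f := by
    rw [← sq_eq_sq₀ (norm_nonneg _) (norm_nonneg _)]
    change ‖(fourierL2_memLp (complexify f)).toLp _‖ ^ 2 = _
    rw [← norm_complexify f, ← fourierL2_integral (complexify f), norm_sq_eq_integral]
    apply integral_congr_ae
    filter_upwards [(fourierL2_memLp (complexify f)).coeFn_toLp] with t ht
    rw [ht]

theorem fourierIsometry_ae (f : Lp ℝ 2 (volume : Measure ℝ)) :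
    fourierIsometry f =ᵐ[volume] fourierReal f :=
  (fourierL2_memLp (complexify f)).coeFn_toLp

/-- `f̂(t) exp(σ² t² / 4)`, whose square is the weighted density in the norm below. -/
def weighted (σ : ℝ) (f : Lp ℝ 2 (volume : Measure ℝ)) (t : ℝ) : ℂ :=
  (Real.exp (σ ^ 2 / 4 * t ^ 2) : ℂ) * fourierReal f t

theorem exp_quarter_sq (σ t : ℝ) :
    Real.exp (σ ^ 2 / 4 * t ^ 2) ^ 2 = Real.exp (σ ^ 2 / 2 * t ^ 2) := by
  rw [← Real.exp_nat_mul]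
  congr 1
  push_cast
  ring

theorem norm_weighted_sq (σ : ℝ) (f : Lp ℝ 2 (volume : Measure ℝ)) (t : ℝ) :
    ‖weighted σ f t‖ ^ 2 = ‖fourierReal f t‖ ^ 2 * Real.exp (σ ^ 2 / 2 * t ^ 2) := by
  rw [weighted, norm_mul, mul_pow, Complex.norm_real, Real.norm_eq_abs, sq_abs, exp_quarter_sq,
    mul_comm]

theorem weighted_memLp_iff (σ : ℝ) (f : Lp ℝ 2 (volume : Measure ℝ)) :
    MemLp (weighted σ f) 2 volume ↔
      Integrable (fun t => ‖fourierReal f t‖ ^ 2 * Real.exp (σ ^ 2 / 2 * t ^ 2)) := by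
  have h : AEStronglyMeasurable (weighted σ f) volume := by
    refine AEStronglyMeasurable.mul ?_ (fourierL2_aesm _)
    exact (by fun_prop : Continuous fun t : ℝ =>
      (Real.exp (σ ^ 2 / 4 * t ^ 2) : ℂ)).aestronglyMeasurable
  rw [memLp_two_iff_integrable_sq_norm h]
  simp_rw [norm_weighted_sq]

theorem weighted_add (σ : ℝ) (f g : Lp ℝ 2 (volume : Measure ℝ)) :
    weighted σ (f + g) =ᵐ[volume] weighted σ f + weighted σ g := by
  filter_upwards [fourierReal_add f g] with t ht
  simp [weighted, ht, mul_add]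

theorem weighted_smul (σ c : ℝ) (f : Lp ℝ 2 (volume : Measure ℝ)) :
    weighted σ (c • f) =ᵐ[volume] c • weighted σ f := by
  filter_upwards [fourierReal_smul c f] with t ht
  simp only [weighted, ht, Pi.smul_apply, Complex.real_smul]
  ring

/-- The linear space of all `f ∈ L²(ℝ)`, real valued, with
`∫ |f̂(t)|² exp(σ² t² / 2) dt < ∞`. -/
def gaussianSubmodule (σ : ℝ) : Submodule ℝ (Lp ℝ 2 (volume : Measure ℝ)) where
  carrier := {f | Integrable (fun t => ‖fourierReal f t‖ ^ 2 * Real.exp (σ ^ 2 / 2 * t ^ 2))}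
  zero_mem' := by
    rw [Set.mem_ofPred_eq, ← weighted_memLp_iff]
    have h := weighted_smul σ 0 0
    rw [zero_smul, zero_smul] at h
    exact (memLp_congr_ae h).2 MemLp.zero
  add_mem' {f g} hf hg := by
    rw [Set.mem_ofPred_eq, ← weighted_memLp_iff] at *
    exact (memLp_congr_ae (weighted_add σ f g)).2 (hf.add hg)
  smul_mem' c f hf := by
    rw [Set.mem_ofPred_eq, ← weighted_memLp_iff] at *
    exact (memLp_congr_ae (weighted_smul σ c f)).2 (hf.const_smul c)

/-- The real reproducing kernel Hilbert space `H_G` of the Gaussian kernel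
`k_G(x, y) = (√(2π) σ)⁻¹ exp(-(x - y)² / (2σ²))`, `σ > 0`, in its Fourier description: all real
`f ∈ L²(ℝ)` with `∫ |f̂(t)|² exp(σ² t² / 2) dt < ∞`. This is a separate type, because it carries its
own inner product and not that of `L²`. -/
def GaussianRKHS (σ : ℝ) : Type := gaussianSubmodule σ

namespace GaussianRKHS

variable {σ : ℝ}

instance : AddCommGroup (GaussianRKHS σ) := inferInstanceAs (AddCommGroup (gaussianSubmodule σ))

instance : Module ℝ (GaussianRKHS σ) := inferInstanceAs (Module ℝ (gaussianSubmodule σ))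

/-- The underlying square integrable function (an almost everywhere class). -/
def toL2 : GaussianRKHS σ →ₗ[ℝ] Lp ℝ 2 (volume : Measure ℝ) := (gaussianSubmodule σ).subtype

theorem toL2_injective : Function.Injective (toL2 (σ := σ)) := Subtype.val_injective

theorem weighted_memLp (f : GaussianRKHS σ) : MemLp (weighted σ (toL2 f)) 2 volume :=
  (weighted_memLp_iff σ _).2 (Subtype.property f)

/-- `f ↦ f̂(t) exp(σ² t² / 4)`, as a linear map into `L²(ℝ, ℂ)`. -/
def embed (σ : ℝ) : GaussianRKHS σ →ₗ[ℝ] Lp ℂ 2 (volume : Measure ℝ) where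
  toFun f := (weighted_memLp f).toLp _
  map_add' f g := by
    rw [← MemLp.toLp_add]
    exact MemLp.toLp_congr _ _ (weighted_add σ _ _)
  map_smul' c f := by
    rw [RingHom.id_apply, ← MemLp.toLp_const_smul]
    exact MemLp.toLp_congr _ _ (weighted_smul σ c _)

theorem embed_ae (f : GaussianRKHS σ) : embed σ f =ᵐ[volume] weighted σ (toL2 f) :=
  (weighted_memLp f).coeFn_toLp

/-- The inner product `∫ f̂(t) conj(ĝ(t)) exp(σ² t² / 2) dt`. For real-valued `f` and `g` this
integral is a real number; the real part only turns it into an element of `ℝ`. -/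
def innerG (f g : GaussianRKHS σ) : ℝ :=
  (∫ t : ℝ, fourierReal (toL2 f) t * (starRingEnd ℂ) (fourierReal (toL2 g) t) *
    (Real.exp (σ ^ 2 / 2 * t ^ 2) : ℂ)).re

theorem innerG_eq (f g : GaussianRKHS σ) :
    innerG f g = (inner ℂ (embed σ g) (embed σ f)).re := by
  rw [L2.inner_def, innerG]
  congr 1
  apply integral_congr_ae
  filter_upwards [embed_ae f, embed_ae g] with t hf hg
  rw [hf, hg, RCLike.inner_apply, weighted, weighted, ← exp_quarter_sq]
  simp only [map_mul, Complex.conj_ofReal]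
  push_cast
  ring

theorem norm_toL2_le_embed (f : GaussianRKHS σ) : ‖toL2 f‖ ≤ ‖embed σ f‖ := by
  rw [← fourierIsometry.norm_map]
  apply Lp.norm_le_norm_of_ae_le
  filter_upwards [embed_ae f, fourierIsometry_ae (toL2 f)] with t h1 h2
  rw [h1, h2, weighted, norm_mul, Complex.norm_real, Real.norm_eq_abs, Real.abs_exp]
  exact le_mul_of_one_le_left (norm_nonneg _) (Real.one_le_exp (by positivity))

/-- `H_G` with the inner product `innerG`. -/
@[reducible] def core (σ : ℝ) : InnerProductSpace.Core ℝ (GaussianRKHS σ) where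
  inner := innerG
  conj_inner_symm f g := by
    change innerG g f = innerG f g
    rw [innerG_eq, innerG_eq]
    exact inner_re_symm (𝕜 := ℂ) _ _
  re_inner_nonneg f := by
    change 0 ≤ innerG f f
    rw [innerG_eq]
    exact inner_self_nonneg (𝕜 := ℂ)
  add_left f g h := by
    change innerG (f + g) h = innerG f h + innerG g h
    simp only [innerG_eq, map_add, inner_add_right, Complex.add_re]
  smul_left f g r := by
    change innerG (r • f) g = r * innerG f g
    simp only [innerG_eq, map_smul, inner_smul_right_eq_smul, Complex.real_smul,
      Complex.re_ofReal_mul]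
  definite f hf := by
    change innerG f f = 0 at hf
    rw [innerG_eq] at hf
    have h0 : ‖embed σ f‖ ^ 2 = 0 := (inner_self_eq_norm_sq (𝕜 := ℂ) (embed σ f)).symm.trans hf
    have h1 : ‖embed σ f‖ = 0 := by simpa using h0
    have h2 : toL2 f = 0 := norm_le_zero_iff.1 ((norm_toL2_le_embed f).trans h1.le)
    exact toL2_injective (h2.trans (map_zero _).symm)

instance instNormedAddCommGroup : NormedAddCommGroup (GaussianRKHS σ) :=
  (core σ).toNormedAddCommGroup

instance instInnerProductSpace : InnerProductSpace ℝ (GaussianRKHS σ) :=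
  InnerProductSpace.ofCore (core σ).toCore

theorem inner_def (f g : GaussianRKHS σ) : inner ℝ f g = innerG f g := rfl

theorem norm_embed (f : GaussianRKHS σ) : ‖embed σ f‖ = ‖f‖ := by
  rw [← sq_eq_sq₀ (norm_nonneg _) (norm_nonneg _), ← real_inner_self_eq_norm_sq f, inner_def,
    innerG_eq]
  exact (inner_self_eq_norm_sq (𝕜 := ℂ) (embed σ f)).symm

theorem norm_toL2_le (f : GaussianRKHS σ) : ‖toL2 f‖ ≤ ‖f‖ :=
  (norm_toL2_le_embed f).trans_eq (norm_embed f)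

theorem norm_exp_neg_le (σ t : ℝ) : ‖(Real.exp (-(σ ^ 2 / 4 * t ^ 2)) : ℂ)‖ ≤ 1 := by
  rw [Complex.norm_real, Real.norm_eq_abs, Real.abs_exp, Real.exp_le_one_iff]
  have : 0 ≤ σ ^ 2 / 4 * t ^ 2 := by positivity
  linarith

theorem damp_memLp (σ : ℝ) (F : Lp ℂ 2 (volume : Measure ℝ)) :
    MemLp (fun t => (Real.exp (-(σ ^ 2 / 4 * t ^ 2)) : ℂ) * F t) 2 volume := by
  have h : Continuous fun t : ℝ => (Real.exp (-(σ ^ 2 / 4 * t ^ 2)) : ℂ) := by fun_prop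
  refine (Lp.memLp F).mono (h.aestronglyMeasurable.mul (Lp.aestronglyMeasurable F)) ?_
  refine Filter.Eventually.of_forall fun t => ?_
  rw [norm_mul]
  exact mul_le_of_le_one_left (norm_nonneg _) (norm_exp_neg_le σ t)

/-- Multiplication by `exp(-σ² t² / 4)` on `L²(ℝ, ℂ)`. -/
def damp (σ : ℝ) : Lp ℂ 2 (volume : Measure ℝ) →L[ℂ] Lp ℂ 2 (volume : Measure ℝ) :=
  LinearMap.mkContinuous
    { toFun := fun F => (damp_memLp σ F).toLp _
      map_add' := fun F G => by
        rw [← MemLp.toLp_add]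
        refine MemLp.toLp_congr _ _ ?_
        filter_upwards [Lp.coeFn_add F G] with t ht
        simp only [ht, Pi.add_apply, mul_add]
      map_smul' := fun c F => by
        rw [RingHom.id_apply, ← MemLp.toLp_const_smul]
        refine MemLp.toLp_congr _ _ ?_
        filter_upwards [Lp.coeFn_smul c F] with t ht
        simp only [ht, Pi.smul_apply, smul_eq_mul]
        ring }
    1 fun F => by
      rw [one_mul]
      apply Lp.norm_le_norm_of_ae_le
      filter_upwards [(damp_memLp σ F).coeFn_toLp] with t ht
      simp only [LinearMap.coe_mk, AddHom.coe_mk]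
      rw [ht, norm_mul]
      exact mul_le_of_le_one_left (norm_nonneg _) (norm_exp_neg_le σ t)

theorem damp_ae (σ : ℝ) (F : Lp ℂ 2 (volume : Measure ℝ)) :
    damp σ F =ᵐ[volume] fun t => (Real.exp (-(σ ^ 2 / 4 * t ^ 2)) : ℂ) * F t :=
  (damp_memLp σ F).coeFn_toLp

theorem exp_mul_exp_neg (σ t : ℝ) :
    (Real.exp (σ ^ 2 / 4 * t ^ 2) : ℂ) * (Real.exp (-(σ ^ 2 / 4 * t ^ 2)) : ℂ) = 1 := by
  rw [← Complex.ofReal_mul, ← Real.exp_add, add_neg_cancel, Real.exp_zero, Complex.ofReal_one]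

theorem range_embed :
    Set.range (embed σ) = damp σ ⁻¹' Set.range (fourierIsometry) := by
  ext F
  constructor
  · rintro ⟨f, rfl⟩
    refine ⟨toL2 f, Lp.ext ?_⟩
    filter_upwards [fourierIsometry_ae (toL2 f), damp_ae σ (embed σ f), embed_ae f] with t h1 h2 h3
    rw [h1, h2, h3, weighted, ← mul_assoc, mul_comm (Complex.ofReal _), exp_mul_exp_neg, one_mul]
  · rintro ⟨f, hf⟩
    have h : weighted σ f =ᵐ[volume] F := by
      have h2 := damp_ae σ F
      rw [← hf] at h2
      filter_upwards [fourierIsometry_ae f, h2] with t h1 h2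
      rw [weighted, ← h1, h2, ← mul_assoc, exp_mul_exp_neg, one_mul]
    have hm : f ∈ gaussianSubmodule σ :=
      (weighted_memLp_iff σ f).1 ((memLp_congr_ae h).2 (Lp.memLp F))
    refine ⟨(⟨f, hm⟩ : gaussianSubmodule σ), Lp.ext ?_⟩
    exact (embed_ae _).trans h

instance instCompleteSpace : CompleteSpace (GaussianRKHS σ) := by
  let Φ : GaussianRKHS σ →ₗᵢ[ℝ] Lp ℂ 2 (volume : Measure ℝ) := ⟨embed σ, norm_embed⟩
  rw [completeSpace_iff_isComplete_range Φ.isometry.isUniformInducing]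
  apply IsClosed.isComplete
  change IsClosed (Set.range (embed σ))
  rw [range_embed]
  exact (fourierIsometry.isometry.isClosedEmbedding.isClosed_range).preimage (damp σ).continuous

end GaussianRKHS

section Covariance

theorem gaussianReal_le (μ : ℝ) {v : NNReal} (hv : v ≠ 0) :
    gaussianReal μ v ≤ ENNReal.ofReal (√(2 * Real.pi * v))⁻¹ • volume := by
  rw [gaussianReal_of_var_ne_zero μ hv, ← withDensity_const]
  refine withDensity_mono (Filter.Eventually.of_forall fun x => ENNReal.ofReal_le_ofReal ?_)
  rw [gaussianPDFReal]
  refine mul_le_of_le_one_right (by positivity) (Real.exp_le_one_iff.2 ?_)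
  have : 0 ≤ (x - μ) ^ 2 / (2 * (v : ℝ)) := by positivity
  rw [neg_div]
  linarith

theorem integrable_mul_gaussian (μ : ℝ) {v : NNReal} (hv : v ≠ 0)
    (f g : Lp ℝ 2 (volume : Measure ℝ)) :
    Integrable (fun x => f x * g x) (gaussianReal μ v) :=
  (((Lp.memLp f).integrable_mul (Lp.memLp g)).smul_measure ENNReal.ofReal_ne_top).mono_measure
    (gaussianReal_le μ hv)

theorem abs_integral_mul_gaussian_le (μ : ℝ) {v : NNReal} (hv : v ≠ 0)
    (f g : Lp ℝ 2 (volume : Measure ℝ)) :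
    |∫ x, f x * g x ∂gaussianReal μ v| ≤ (√(2 * Real.pi * v))⁻¹ * (‖f‖ * ‖g‖) := by
  have hi : Integrable (fun x => f x * g x) volume := (Lp.memLp f).integrable_mul (Lp.memLp g)
  have h1 : ∫ x, ‖f x * g x‖ ∂gaussianReal μ v ≤
      ∫ x, ‖f x * g x‖ ∂(ENNReal.ofReal (√(2 * Real.pi * v))⁻¹ • (volume : Measure ℝ)) :=
    integral_mono_measure (gaussianReal_le μ hv)
      (Filter.Eventually.of_forall fun x => norm_nonneg _)
      (hi.norm.smul_measure ENNReal.ofReal_ne_top)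
  rw [integral_smul_measure, ENNReal.toReal_ofReal (by positivity), smul_eq_mul] at h1
  refine (norm_integral_le_integral_norm _).trans (h1.trans ?_)
  refine mul_le_mul_of_nonneg_left ?_ (by positivity)
  have h2 : ∫ x, ‖f x * g x‖ = inner ℝ (|f|) (|g|) := by
    rw [L2.inner_def]
    apply integral_congr_ae
    filter_upwards [Lp.coeFn_abs f, Lp.coeFn_abs g] with x hf hg
    rw [hf, hg, norm_mul, real_inner_comm, RCLike.inner_apply, conj_trivial]
    rfl
  rw [h2]
  exact (real_inner_le_norm _ _).trans_eq (by rw [norm_abs_eq_norm, norm_abs_eq_norm])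

variable {Ω : Type*} [MeasurableSpace Ω] {P : Measure Ω} {X : Ω → ℝ} {μ σ₀ : ℝ}

theorem var_ne_zero (hσ₀ : 0 < σ₀) : (σ₀ ^ 2).toNNReal ≠ 0 :=
  (Real.toNNReal_pos.2 (by positivity)).ne'

theorem integral_comp_law (hX : HasLaw X (gaussianReal μ (σ₀ ^ 2).toNNReal) P) (hσ₀ : 0 < σ₀)
    (f g : Lp ℝ 2 (volume : Measure ℝ)) :
    ∫ ω, f (X ω) * g (X ω) ∂P = ∫ x, f x * g x ∂gaussianReal μ (σ₀ ^ 2).toNNReal :=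
  hX.integral_comp (f := fun x => f x * g x)
    (integrable_mul_gaussian μ (var_ne_zero hσ₀) f g).aestronglyMeasurable

/-- The bounded bilinear form `(f, g) ↦ E[f(X) g(X)]` on `H_G`, for `X ~ N(μ, σ₀²)`. It does not
depend on the representatives of `f` and `g`, as the law of `X` has a density. -/
def covForm (σ : ℝ) (hσ₀ : 0 < σ₀) (hX : HasLaw X (gaussianReal μ (σ₀ ^ 2).toNNReal) P) :
    GaussianRKHS σ →L[ℝ] GaussianRKHS σ →L[ℝ] ℝ :=
  LinearMap.mkContinuous₂
    (LinearMap.mk₂ ℝ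
      (fun f g => ∫ ω, GaussianRKHS.toL2 f (X ω) * GaussianRKHS.toL2 g (X ω) ∂P)
      (fun f f' g => by
        simp only [integral_comp_law hX hσ₀]
        rw [← integral_add (integrable_mul_gaussian μ (var_ne_zero hσ₀) _ _)
          (integrable_mul_gaussian μ (var_ne_zero hσ₀) _ _), map_add]
        apply integral_congr_ae
        filter_upwards [(gaussianReal_absolutelyContinuous μ (var_ne_zero hσ₀)).ae_le
          (Lp.coeFn_add (GaussianRKHS.toL2 f) (GaussianRKHS.toL2 f'))] with x hx
        rw [hx, Pi.add_apply, add_mul])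
      (fun c f g => by
        simp only [integral_comp_law hX hσ₀]
        rw [smul_eq_mul, ← integral_const_mul, map_smul]
        apply integral_congr_ae
        filter_upwards [(gaussianReal_absolutelyContinuous μ (var_ne_zero hσ₀)).ae_le
          (Lp.coeFn_smul c (GaussianRKHS.toL2 f))] with x hx
        rw [hx, Pi.smul_apply, smul_eq_mul, mul_assoc])
      (fun f g g' => by
        simp only [integral_comp_law hX hσ₀]
        rw [← integral_add (integrable_mul_gaussian μ (var_ne_zero hσ₀) _ _)
          (integrable_mul_gaussian μ (var_ne_zero hσ₀) _ _), map_add]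
        apply integral_congr_ae
        filter_upwards [(gaussianReal_absolutelyContinuous μ (var_ne_zero hσ₀)).ae_le
          (Lp.coeFn_add (GaussianRKHS.toL2 g) (GaussianRKHS.toL2 g'))] with x hx
        rw [hx, Pi.add_apply, mul_add])
      (fun c f g => by
        simp only [integral_comp_law hX hσ₀]
        rw [smul_eq_mul, ← integral_const_mul, map_smul]
        apply integral_congr_ae
        filter_upwards [(gaussianReal_absolutelyContinuous μ (var_ne_zero hσ₀)).ae_le
          (Lp.coeFn_smul c (GaussianRKHS.toL2 g))] with x hx
        rw [hx, Pi.smul_apply, smul_eq_mul]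
        ring))
    (√(2 * Real.pi * (σ₀ ^ 2).toNNReal))⁻¹
    (fun f g => by
      rw [LinearMap.mk₂_apply, integral_comp_law hX hσ₀, mul_assoc]
      refine (abs_integral_mul_gaussian_le μ (var_ne_zero hσ₀) _ _).trans ?_
      gcongr
      · exact GaussianRKHS.norm_toL2_le f
      · exact GaussianRKHS.norm_toL2_le g)

/-- The covariance operator `C_XX : H_G → H_G` of `X ~ N(μ, σ₀²)`, the bounded linear operator that
represents the form `E[f(X) g(X)]`. -/
def covOp (σ : ℝ) (hσ₀ : 0 < σ₀) (hX : HasLaw X (gaussianReal μ (σ₀ ^ 2).toNNReal) P) :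
    GaussianRKHS σ →L[ℝ] GaussianRKHS σ :=
  InnerProductSpace.continuousLinearMapOfBilin (𝕜 := ℝ) (covForm σ hσ₀ hX)

/-- The defining property of `C_XX`. -/
theorem inner_covOp (σ : ℝ) (hσ₀ : 0 < σ₀)
    (hX : HasLaw X (gaussianReal μ (σ₀ ^ 2).toNNReal) P) (f g : GaussianRKHS σ) :
    inner ℝ (covOp σ hσ₀ hX f) g =
      ∫ ω, GaussianRKHS.toL2 f (X ω) * GaussianRKHS.toL2 g (X ω) ∂P :=
  InnerProductSpace.continuousLinearMapOfBilin_apply (𝕜 := ℝ) (covForm σ hσ₀ hX) f g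

end Covariance

end KernelBayes

end

/-! Under the weight exp(σ²t²/2) the transform of k_a becomes a constant multiple of the phase
exp(-ita), so pairing with k_a amounts, up to a positive constant, to evaluation at a. The test
functions are g_w(x) = k_a(x) cos(2πw(x - a)): they lie in H_G and equal 1 at a, so ⟨k_a, g_w⟩ is a
positive number independent of w. If k_a = C_XX f, that number is E[f(X) g_w(X)] = ∫ p f k_a
cos(2πw(x - a)) dx, with p the density of X. As f and k_a are in L² and p is bounded, p f k_a is
integrable, so by Riemann–Lebesgue the integral tends to 0 as w → ∞, a contradiction.

Elements of H_G are almost everywhere classes, so the pairing is computed on the Fourier side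
(`inner_cosGaussianRKHS`) from the explicit transform (`fourierReal_cosGaussian`); this needs the L²
transform to agree with the Fourier integral. The decay is
`tendsto_integral_mul_cosGaussian_gaussianReal`. -/

namespace MeasureTheory.Lp

/-- For an integrable `L²` function whose Fourier integral is square integrable, the `L²` Fourier
transform is given by the Fourier integral. -/
theorem fourier_ae_eq_fourierIntegral {f : Lp ℂ 2 (volume : Measure ℝ)} {g : ℝ → ℂ}
    (hfg : f =ᵐ[volume] g) (hg : Integrable g) (hFg : MemLp (𝓕 g) 2 volume) :
    (𝓕 f : Lp ℂ 2 (volume : Measure ℝ)) =ᵐ[volume] 𝓕 g := by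
  have key : (𝓕 f : Lp ℂ 2 (volume : Measure ℝ)) = hFg.toLp _ := by
    -- L² embeds injectively into tempered distributions, so testing against Schwartz functions
    -- suffices.
    refine LinearMap.ker_eq_bot.1
      (ker_toTemperedDistributionCLM_eq_bot (F := ℂ) (μ := (volume : Measure ℝ)) (p := 2)) ?_
    simp only [ContinuousLinearMap.coe_coe, toTemperedDistributionCLM_apply]
    rw [← fourier_toTemperedDistribution_eq]
    ext φ
    rw [TemperedDistribution.fourier_apply, toTemperedDistribution_apply,
      toTemperedDistribution_apply]
    calc ∫ x, (𝓕 φ) x • f x = ∫ x, (𝓕 (φ : ℝ → ℂ)) x • g x := by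
          refine integral_congr_ae ?_
          filter_upwards [hfg] with x hx
          rw [hx, SchwartzMap.fourier_coe]
      _ = ∫ x, φ x • (𝓕 g) x := by
          -- The multiplication formula ∫ φ̂ g = ∫ φ ĝ for integrable φ and g.
          simpa using! VectorFourier.integral_fourierIntegral_smul_eq_flip (L := innerₗ ℝ)
            Real.continuous_fourierChar continuous_inner φ.integrable hg
      _ = ∫ x, φ x • (hFg.toLp (𝓕 g)) x := by
          refine integral_congr_ae ?_
          filter_upwards [hFg.coeFn_toLp] with x hx
          rw [hx]
  rw [key]
  exact hFg.coeFn_toLp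

end MeasureTheory.Lp

/-! ### Modulated Gaussians and their Fourier transforms -/

namespace KernelBayes

open Complex in
theorem memLp_two_cexp_quadratic {b : ℂ} (hb : b.re < 0) (c d : ℂ) :
    MemLp (fun x : ℝ => cexp (b * x ^ 2 + c * x + d)) 2 volume := by
  refine (memLp_two_iff_integrable_sq_norm (by fun_prop)).2 ?_
  have h := (integrable_cexp_quadratic' (b := 2 * b) (by simpa using by linarith) (2 * c)
    (2 * d)).norm
  refine h.congr (Filter.Eventually.of_forall fun x => ?_)
  simp only [← norm_pow, ← Complex.exp_nat_mul]
  congr 2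
  push_cast
  ring

/-- The Gaussian `exp(-(x - a)² / (2σ²))` modulated by `exp(2πiw(x - a))`. -/
noncomputable def gaborAtom (σ a w : ℝ) (x : ℝ) : ℂ :=
  Complex.exp (-(1 / (2 * σ ^ 2) : ℂ) * x ^ 2 + (a / σ ^ 2 + 2 * Real.pi * w * Complex.I) * x +
    (-(a ^ 2 / (2 * σ ^ 2)) - 2 * Real.pi * w * a * Complex.I))

/-- The Gaussian `exp(-(x - a)² / (2σ²))` modulated by `cos(2πw(x - a))`. -/
noncomputable def cosGaussian (σ a w : ℝ) (x : ℝ) : ℝ :=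
  Real.exp (-(x - a) ^ 2 / (2 * σ ^ 2)) * Real.cos (2 * Real.pi * w * (x - a))

section

variable {σ : ℝ}

theorem neg_inv_two_sq_re_neg (hσ : 0 < σ) : (-(1 / (2 * σ ^ 2) : ℂ)).re < 0 := by
  have : (-(1 / (2 * σ ^ 2) : ℂ)) = ((-(1 / (2 * σ ^ 2)) : ℝ) : ℂ) := by push_cast; rfl
  rw [this, Complex.ofReal_re, neg_lt_zero]
  positivity

theorem gaborAtom_eq (hσ : 0 < σ) (a w x : ℝ) :
    gaborAtom σ a w x = (Real.exp (-(x - a) ^ 2 / (2 * σ ^ 2)) : ℂ) *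
      Complex.exp ((2 * Real.pi * w * (x - a) : ℝ) * Complex.I) := by
  have : (σ : ℂ) ≠ 0 := by exact_mod_cast hσ.ne'
  rw [gaborAtom, Complex.ofReal_exp, ← Complex.exp_add]
  congr 1
  push_cast
  field

theorem cosGaussian_eq (hσ : 0 < σ) (a w x : ℝ) :
    (cosGaussian σ a w x : ℂ) = 2⁻¹ * (gaborAtom σ a w x + gaborAtom σ a (-w) x) := by
  rw [gaborAtom_eq hσ, gaborAtom_eq hσ, cosGaussian, Complex.ofReal_mul, Complex.ofReal_cos,
    Complex.cos]
  push_cast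
  ring_nf

/-- The Fourier kernel only shifts the linear coefficient of the exponent, so this is a complex
Gaussian integral. Since the modulation is centred at a, the resulting phase does not involve w. -/
theorem fourier_gaborAtom (hσ : 0 < σ) (a w s : ℝ) :
    𝓕 (gaborAtom σ a w) s = (2 * Real.pi * σ ^ 2 : ℂ) ^ (1 / 2 : ℂ) *
      (Complex.exp (-(2 * Real.pi * s * a : ℝ) * Complex.I) *
        (Real.exp (-(2 * Real.pi ^ 2 * σ ^ 2 * (s - w) ^ 2)) : ℂ)) := by
  have h0 : (σ : ℂ) ≠ 0 := by exact_mod_cast hσ.ne'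
  have h := integral_cexp_quadratic (neg_inv_two_sq_re_neg hσ)
    (a / σ ^ 2 + 2 * Real.pi * (w - s) * Complex.I)
    (-(a ^ 2 / (2 * σ ^ 2)) - 2 * Real.pi * w * a * Complex.I)
  rw [Real.fourier_real_eq_integral_exp_smul]
  refine Eq.trans (integral_congr_ae (Filter.Eventually.of_forall fun x => ?_)) (h.trans ?_)
  · simp only [gaborAtom, smul_eq_mul, ← Complex.exp_add]
    congr 1
    push_cast
    ring
  · congr 1
    · congr 1
      field
    · rw [Complex.ofReal_exp, ← Complex.exp_add]
      congr 1
      push_cast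
      field_simp
      ring_nf
      simp only [Complex.I_sq]
      ring

theorem integrable_gaborAtom (hσ : 0 < σ) (a w : ℝ) : Integrable (gaborAtom σ a w) :=
  integrable_cexp_quadratic' (neg_inv_two_sq_re_neg hσ) _ _

theorem memLp_gaborAtom (hσ : 0 < σ) (a w : ℝ) : MemLp (gaborAtom σ a w) 2 volume :=
  memLp_two_cexp_quadratic (neg_inv_two_sq_re_neg hσ) _ _

/-- The unitary Fourier transform of `cosGaussian` up to a factor independent of `a`, `w`, `t`. -/
noncomputable def cosGaussianFourier (σ a w t : ℝ) : ℂ :=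
  Complex.exp (-(t * a : ℝ) * Complex.I) *
    (2⁻¹ * (Real.exp (-(σ ^ 2 / 2 * (t - 2 * Real.pi * w) ^ 2)) +
      Real.exp (-(σ ^ 2 / 2 * (t + 2 * Real.pi * w) ^ 2))) : ℝ)

theorem fourier_cosGaussian (hσ : 0 < σ) (a w s : ℝ) :
    𝓕 (fun x => (cosGaussian σ a w x : ℂ)) s =
      (2 * Real.pi * σ ^ 2 : ℂ) ^ (1 / 2 : ℂ) * cosGaussianFourier σ a w (2 * Real.pi * s) := by
  have h : (fun x => (cosGaussian σ a w x : ℂ)) =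
      (2⁻¹ : ℂ) • (gaborAtom σ a w + gaborAtom σ a (-w)) := by
    ext x
    simp [cosGaussian_eq hσ]
  have hadd : 𝓕 (gaborAtom σ a w + gaborAtom σ a (-w)) s =
      𝓕 (gaborAtom σ a w) s + 𝓕 (gaborAtom σ a (-w)) s := by
    simp only [Real.fourier_eq, Pi.add_apply, smul_add]
    refine integral_add ?_ ?_
    · exact (Real.fourierIntegral_convergent_iff s).2 (integrable_gaborAtom hσ a w)
    · exact (Real.fourierIntegral_convergent_iff s).2 (integrable_gaborAtom hσ a (-w))
  have hsmul : 𝓕 ((2⁻¹ : ℂ) • (gaborAtom σ a w + gaborAtom σ a (-w))) s =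
      2⁻¹ * 𝓕 (gaborAtom σ a w + gaborAtom σ a (-w)) s :=
    congrFun (VectorFourier.fourierIntegral_const_smul _ _ _ _ _) s
  rw [h, hsmul, hadd, fourier_gaborAtom hσ, fourier_gaborAtom hσ,
    cosGaussianFourier]
  have e1 : -(σ ^ 2 / 2 * (2 * Real.pi * s - 2 * Real.pi * w) ^ 2) =
    -(2 * Real.pi ^ 2 * σ ^ 2 * (s - w) ^ 2) := by ring
  have e2 : -(σ ^ 2 / 2 * (2 * Real.pi * s + 2 * Real.pi * w) ^ 2) =
    -(2 * Real.pi ^ 2 * σ ^ 2 * (s - -w) ^ 2) := by ring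
  rw [e1, e2]
  push_cast
  ring

/-- The transform decays like a Gaussian of rate σ²/2, and a smaller κ leaves the negative quadratic
coefficient κ - σ²/2. The cases needed are κ = 0 and κ = σ²/4. -/
theorem memLp_weighted_cosGaussianFourier (a w : ℝ) {κ : ℝ} (hκ : κ < σ ^ 2 / 2) :
    MemLp (fun t : ℝ => (Real.exp (κ * t ^ 2) : ℂ) * cosGaussianFourier σ a w t) 2 volume := by
  have hb : (((κ - σ ^ 2 / 2 : ℝ) : ℂ)).re < 0 := by
    rw [Complex.ofReal_re]
    linarith
  have h1 := memLp_two_cexp_quadratic hb (σ ^ 2 * (2 * Real.pi * w) - a * Complex.I)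
    (-(σ ^ 2 / 2 * (2 * Real.pi * w) ^ 2))
  have h2 := memLp_two_cexp_quadratic hb (-(σ ^ 2 * (2 * Real.pi * w)) - a * Complex.I)
    (-(σ ^ 2 / 2 * (2 * Real.pi * w) ^ 2))
  refine (memLp_congr_ae (Filter.Eventually.of_forall fun t => ?_)).1
    ((h1.add h2).const_mul (2⁻¹ : ℂ))
  have e1 : Complex.exp (((κ - σ ^ 2 / 2 : ℝ) : ℂ) * t ^ 2 +
      (σ ^ 2 * (2 * Real.pi * w) - a * Complex.I) * t + -(σ ^ 2 / 2 * (2 * Real.pi * w) ^ 2)) =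
      Complex.exp (κ * t ^ 2) * (Complex.exp (-(t * a) * Complex.I) *
        Complex.exp (-(σ ^ 2 / 2 * (t - 2 * Real.pi * w) ^ 2))) := by
    rw [← Complex.exp_add, ← Complex.exp_add]
    congr 1
    push_cast
    ring
  have e2 : Complex.exp (((κ - σ ^ 2 / 2 : ℝ) : ℂ) * t ^ 2 +
      (-(σ ^ 2 * (2 * Real.pi * w)) - a * Complex.I) * t + -(σ ^ 2 / 2 * (2 * Real.pi * w) ^ 2)) =
      Complex.exp (κ * t ^ 2) * (Complex.exp (-(t * a) * Complex.I) *
        Complex.exp (-(σ ^ 2 / 2 * (t + 2 * Real.pi * w) ^ 2))) := by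
    rw [← Complex.exp_add, ← Complex.exp_add]
    congr 1
    push_cast
    ring
  simp only [cosGaussianFourier, Pi.add_apply, e1, e2]
  push_cast
  ring

theorem memLp_cosGaussian (hσ : 0 < σ) (a w : ℝ) : MemLp (cosGaussian σ a w) 2 volume := by
  have h := (((memLp_gaborAtom hσ a w).add (memLp_gaborAtom hσ a (-w))).const_mul (2⁻¹ : ℂ)).re
  refine (memLp_congr_ae (Filter.Eventually.of_forall fun x => ?_)).1 h
  simp only [Pi.add_apply, ← cosGaussian_eq hσ, RCLike.re_eq_complex_re, Complex.ofReal_re]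

theorem integrable_ofReal_cosGaussian (hσ : 0 < σ) (a w : ℝ) :
    Integrable fun x => (cosGaussian σ a w x : ℂ) := by
  have h := ((integrable_gaborAtom hσ a w).add (integrable_gaborAtom hσ a (-w))).const_mul (2⁻¹ : ℂ)
  refine h.congr (Filter.Eventually.of_forall fun x => ?_)
  simp only [Pi.add_apply, cosGaussian_eq hσ]

/-- The factor between `cosGaussianFourier` and the unitary Fourier transform of `cosGaussian`. -/
noncomputable def gaussianFourierConst (σ : ℝ) : ℂ :=
  ((√(2 * Real.pi))⁻¹ : ℝ) * (2 * Real.pi * σ ^ 2 : ℂ) ^ (1 / 2 : ℂ)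

theorem gaussianFourierConst_ne_zero (hσ : 0 < σ) : gaussianFourierConst σ ≠ 0 := by
  have h1 : (√(2 * Real.pi))⁻¹ ≠ 0 := by positivity
  have h2 : (2 * Real.pi * σ ^ 2 : ℂ) ≠ 0 := by
    have : 2 * Real.pi * σ ^ 2 ≠ 0 := by positivity
    exact_mod_cast this
  refine mul_ne_zero (by exact_mod_cast h1) ?_
  rw [Ne, Complex.cpow_eq_zero_iff]
  exact fun h => h2 h.1

theorem fourierReal_cosGaussian (hσ : 0 < σ) (a w : ℝ) :
    fourierReal ((memLp_cosGaussian hσ a w).toLp _) =ᵐ[volume]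
      fun t => gaussianFourierConst σ * cosGaussianFourier σ a w t := by
  have hae : complexify ((memLp_cosGaussian hσ a w).toLp _) =ᵐ[volume]
      fun x => (cosGaussian σ a w x : ℂ) := by
    filter_upwards [Complex.ofRealCLM.coeFn_compLp ((memLp_cosGaussian hσ a w).toLp _),
      (memLp_cosGaussian hσ a w).coeFn_toLp] with x h1 h2
    rw [complexify, h1, h2, Complex.ofRealCLM_apply]
  have hF : MemLp (𝓕 fun x => (cosGaussian σ a w x : ℂ)) 2 volume := by
    -- κ = 0 is plain square integrability in angular frequency; the dilation by 2π transfers it to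
    -- `𝓕`.
    have h := memLp_weighted_cosGaussianFourier (σ := σ) a w (κ := 0) (by positivity)
    simp only [zero_mul, Real.exp_zero, Complex.ofReal_one, one_mul] at h
    have hm : AEStronglyMeasurable (𝓕 fun x => (cosGaussian σ a w x : ℂ)) volume := by
      simp_rw [funext (fourier_cosGaussian hσ a w)]
      unfold cosGaussianFourier
      fun_prop
    rw [memLp_two_iff_integrable_sq_norm hm]
    have h2 := (((memLp_two_iff_integrable_sq_norm h.1).1 h).comp_mul_left'
      two_pi_pos.ne').const_mul (‖(2 * Real.pi * σ ^ 2 : ℂ) ^ (1 / 2 : ℂ)‖ ^ 2)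
    refine h2.congr (Filter.Eventually.of_forall fun s => ?_)
    simp only [fourier_cosGaussian hσ, norm_mul, mul_pow]
  filter_upwards [quasi_dilate.ae (Lp.fourier_ae_eq_fourierIntegral hae
    (integrable_ofReal_cosGaussian hσ a w) hF)] with t ht
  rw [fourierReal, fourierL2, ht, fourier_cosGaussian hσ, mul_div_cancel₀ _ two_pi_pos.ne',
    ← mul_assoc, gaussianFourierConst]

/-! ### The test functions in H_G and their pairing with k_a -/

theorem cosGaussian_mem (hσ : 0 < σ) (a w : ℝ) :
    (memLp_cosGaussian hσ a w).toLp _ ∈ gaussianSubmodule σ := by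
  refine (weighted_memLp_iff σ _).1 ?_
  have hκ : σ ^ 2 / 4 < σ ^ 2 / 2 := by
    have := pow_pos hσ 2
    linarith
  have h := (memLp_weighted_cosGaussianFourier a w hκ).const_mul (gaussianFourierConst σ)
  refine (memLp_congr_ae ?_).1 h
  filter_upwards [fourierReal_cosGaussian hσ a w] with t ht
  rw [weighted, ht, mul_left_comm]

/-- `cosGaussian` as an element of the reproducing kernel Hilbert space. -/
noncomputable def cosGaussianRKHS (hσ : 0 < σ) (a w : ℝ) : GaussianRKHS σ :=
  (⟨_, cosGaussian_mem hσ a w⟩ : gaussianSubmodule σ)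

theorem toL2_cosGaussianRKHS (hσ : 0 < σ) (a w : ℝ) :
    GaussianRKHS.toL2 (cosGaussianRKHS hσ a w) =ᵐ[volume] cosGaussian σ a w :=
  (memLp_cosGaussian hσ a w).coeFn_toLp

/-- The inner product of the Gaussian with its modulations does not depend on the frequency. -/
theorem inner_cosGaussianRKHS (hσ : 0 < σ) (a w : ℝ) :
    inner ℝ (cosGaussianRKHS hσ a 0) (cosGaussianRKHS hσ a w) =
      Complex.normSq (gaussianFourierConst σ) * ∫ t : ℝ, Real.exp (-(σ ^ 2 / 2) * t ^ 2) := by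
  have hi : Integrable fun t : ℝ => Real.exp (-(σ ^ 2 / 2) * t ^ 2) :=
    integrable_exp_neg_mul_sq (by positivity)
  have hae : (fun t : ℝ => fourierReal (GaussianRKHS.toL2 (cosGaussianRKHS hσ a 0)) t *
      (starRingEnd ℂ) (fourierReal (GaussianRKHS.toL2 (cosGaussianRKHS hσ a w)) t) *
      (Real.exp (σ ^ 2 / 2 * t ^ 2) : ℂ)) =ᵐ[volume] fun t =>
      ((Complex.normSq (gaussianFourierConst σ) * (2⁻¹ *
        (Real.exp (-(σ ^ 2 / 2) * (t - 2 * Real.pi * w) ^ 2) +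
          Real.exp (-(σ ^ 2 / 2) * (t + 2 * Real.pi * w) ^ 2))) : ℝ) : ℂ) := by
    filter_upwards [fourierReal_cosGaussian hσ a 0, fourierReal_cosGaussian hσ a w] with t h0 h1
    refine Eq.trans (congrArg₂ (· * ·) (congrArg₂ (· * ·) h0 (congrArg _ h1)) rfl) ?_
    -- Both functions are centred at a, so their phases cancel.
    have hphase : Complex.exp (-(t * a : ℝ) * Complex.I) *
        (starRingEnd ℂ) (Complex.exp (-(t * a : ℝ) * Complex.I)) = 1 := by
      rw [← Complex.exp_conj, ← Complex.exp_add]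
      simp
    -- The weight cancels the transform of the unmodulated Gaussian exactly, leaving only the two
    -- bumps at ±2πw.
    have hexp : (Real.exp (-(σ ^ 2 / 2 * t ^ 2)) : ℂ) * (Real.exp (σ ^ 2 / 2 * t ^ 2) : ℂ) = 1 := by
      rw [← Complex.ofReal_mul, ← Real.exp_add, neg_add_cancel, Real.exp_zero, Complex.ofReal_one]
    simp only [cosGaussianFourier, map_mul, Complex.conj_ofReal, mul_zero, sub_zero, add_zero,
      Complex.ofReal_mul, ← Complex.mul_conj, neg_mul (σ ^ 2 / 2)]
    have h2 : (2⁻¹ * (Real.exp (-(σ ^ 2 / 2 * t ^ 2)) + Real.exp (-(σ ^ 2 / 2 * t ^ 2)))) =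
      Real.exp (-(σ ^ 2 / 2 * t ^ 2)) := by ring
    rw [← Complex.ofReal_mul, ← Complex.ofReal_mul, h2, Complex.ofReal_mul]
    rw [Complex.ofReal_mul] at hphase
    -- With P and A the left sides of `hphase` and `hexp`, AP - 1 = A(P - 1) + (A - 1); the
    -- prefactor is the rest of the integrand.
    linear_combination (gaussianFourierConst σ * (starRingEnd ℂ) (gaussianFourierConst σ) *
      (((2⁻¹ : ℝ) : ℂ) * ((Real.exp (-(σ ^ 2 / 2 * (t - 2 * Real.pi * w) ^ 2)) +
        Real.exp (-(σ ^ 2 / 2 * (t + 2 * Real.pi * w) ^ 2)) : ℝ) : ℂ))) *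
      ((Real.exp (-(σ ^ 2 / 2 * t ^ 2)) : ℂ) * (Real.exp (σ ^ 2 / 2 * t ^ 2) : ℂ) * hphase + hexp)
  -- Translation invariance gives both bumps the integral of the centred Gaussian, which removes w.
  rw [GaussianRKHS.inner_def, GaussianRKHS.innerG, integral_congr_ae hae, integral_complex_ofReal,
    Complex.ofReal_re, integral_const_mul, integral_const_mul,
    integral_add (hi.comp_sub_right _) (hi.comp_add_right _),
    integral_sub_right_eq_self (fun t : ℝ => Real.exp (-(σ ^ 2 / 2) * t ^ 2)),
    integral_add_right_eq_self (fun t : ℝ => Real.exp (-(σ ^ 2 / 2) * t ^ 2))]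
  ring

theorem inner_cosGaussianRKHS_pos (hσ : 0 < σ) :
    0 < Complex.normSq (gaussianFourierConst σ) * ∫ t : ℝ, Real.exp (-(σ ^ 2 / 2) * t ^ 2) := by
  refine mul_pos (Complex.normSq_pos.2 (gaussianFourierConst_ne_zero hσ)) ?_
  rw [integral_gaussian]
  positivity

/-! ### Decay of the expectations and the contradiction -/

/-- Riemann–Lebesgue lemma for cosines. -/
theorem tendsto_integral_mul_cos {u : ℝ → ℝ} (hu : Integrable u) (a : ℝ) :
    Filter.Tendsto (fun w : ℝ => ∫ x, u x * Real.cos (2 * Real.pi * w * (x - a)))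
      Filter.atTop (nhds 0) := by
  -- Translating by a centres the cosine at the origin; as u is real, the real part of the Fourier
  -- integral is the cosine integral.
  have h := (Real.zero_at_infty_fourier fun x : ℝ => (u (x + a) : ℂ)).mono_left
    atTop_le_cocompact
  have hre := (Complex.continuous_re.tendsto 0).comp h
  rw [Complex.zero_re] at hre
  refine hre.congr fun w => ?_
  have hi : Integrable fun x : ℝ => (u (x + a) : ℂ) := (hu.comp_add_right a).ofReal
  rw [Function.comp_apply, Real.fourier_eq, ← RCLike.re_eq_complex_re,
    ← integral_re ((Real.fourierIntegral_convergent_iff w).2 hi),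
    ← integral_add_right_eq_self (fun x => u x * Real.cos (2 * Real.pi * w * (x - a))) a]
  refine integral_congr_ae (Filter.Eventually.of_forall fun x => ?_)
  simp only [Circle.smul_def, Real.fourierChar_apply, smul_eq_mul, RCLike.re_eq_complex_re,
    Complex.re_mul_ofReal, Complex.exp_ofReal_mul_I_re, add_sub_cancel_right, RCLike.inner_apply, conj_trivial]
  rw [mul_neg, Real.cos_neg, mul_comm]
  ring_nf

/-- Written against Lebesgue measure, the integrand is the fixed integrable function p f k_a times a
cosine that alone carries w. -/
theorem tendsto_integral_mul_cosGaussian_gaussianReal (hσ : 0 < σ) (a μ : ℝ) {v : NNReal}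
    (hv : v ≠ 0) (f : Lp ℝ 2 (volume : Measure ℝ)) :
    Filter.Tendsto (fun w : ℝ => ∫ x, f x * cosGaussian σ a w x ∂gaussianReal μ v)
      Filter.atTop (nhds 0) := by
  have hi : Integrable fun x => gaussianPDFReal μ v x *
      (f x * Real.exp (-(x - a) ^ 2 / (2 * σ ^ 2))) := by
    -- At w = 0 the cosine is 1, so this is integrability of f k_a under the law of X.
    have h : Integrable (fun x => f x * cosGaussian σ a 0 x) (gaussianReal μ v) := by
      refine (integrable_mul_gaussian μ hv f ((memLp_cosGaussian hσ a 0).toLp _)).congr ?_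
      filter_upwards [(gaussianReal_absolutelyContinuous μ hv).ae_le
        (memLp_cosGaussian hσ a 0).coeFn_toLp] with x hx
      rw [hx]
    rw [gaussianReal_of_var_ne_zero μ hv, integrable_withDensity_iff_integrable_smul'
      (measurable_gaussianPDF μ v) (Filter.Eventually.of_forall fun _ => ENNReal.ofReal_lt_top)] at h
    simpa [cosGaussian, toReal_gaussianPDF] using h
  refine (tendsto_integral_mul_cos hi a).congr fun w => ?_
  rw [integral_gaussianReal_eq_integral_smul hv]
  refine integral_congr_ae (Filter.Eventually.of_forall fun x => ?_)
  simp only [smul_eq_mul, cosGaussian]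
  ring

theorem cosGaussianRKHS_notMem_range_covOp {Ω : Type*} [MeasurableSpace Ω] {P : Measure Ω}
    {X : Ω → ℝ} {μ σ₀ : ℝ} (hσ₀ : 0 < σ₀) (hσ : 0 < σ)
    (hX : HasLaw X (gaussianReal μ (σ₀ ^ 2).toNNReal) P) (a : ℝ) :
    cosGaussianRKHS hσ a 0 ∉ Set.range (covOp σ hσ₀ hX) := by
  rintro ⟨f, hf⟩
  -- The same function of w tends to 0 and is constantly equal to a positive number.
  refine (inner_cosGaussianRKHS_pos hσ).ne (tendsto_nhds_unique
    (tendsto_integral_mul_cosGaussian_gaussianReal hσ a μ (var_ne_zero hσ₀) (GaussianRKHS.toL2 f))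
    (tendsto_const_nhds.congr fun w => ?_))
  rw [← inner_cosGaussianRKHS hσ a w, ← hf, inner_covOp, integral_comp_law hX hσ₀]
  refine integral_congr_ae ?_
  filter_upwards [(gaussianReal_absolutelyContinuous μ (var_ne_zero hσ₀)).ae_le
    (toL2_cosGaussianRKHS hσ a w)] with x hx
  rw [hx]

end

end KernelBayes

theorem mainTheorem1 {Ω : Type*} [MeasurableSpace Ω] (P : Measure Ω) (X : Ω → ℝ)
    (μ σ₀ σ : ℝ) (hσ₀ : 0 < σ₀) (hσ : 0 < σ)
    (hX : HasLaw X (gaussianReal μ (σ₀ ^ 2).toNNReal) P) :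
    (∀ a : ℝ, ∃ k : KernelBayes.GaussianRKHS σ,
      (KernelBayes.GaussianRKHS.toL2 k =ᵐ[volume]
        fun x : ℝ => Real.exp (-(x - a) ^ 2 / (2 * σ ^ 2))) ∧
      k ∉ Set.range (KernelBayes.covOp σ hσ₀ hX)) ∧
    ¬ Function.Surjective (KernelBayes.covOp σ hσ₀ hX) := by
  have hk : ∀ a : ℝ, KernelBayes.cosGaussianRKHS hσ a 0 ∉
      Set.range (KernelBayes.covOp σ hσ₀ hX) :=
    KernelBayes.cosGaussianRKHS_notMem_range_covOp hσ₀ hσ hX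
  refine ⟨fun a => ⟨KernelBayes.cosGaussianRKHS hσ a 0, ?_, hk a⟩, fun h => hk 0 (h _)⟩
  filter_upwards [KernelBayes.toL2_cosGaussianRKHS hσ a 0] with x hx
  simp [hx, KernelBayes.cosGaussian]
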